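/- Let $n\ge 2$ and $a_1,\dots,a_n\in[0,1]$. For $x\in\{0,1\}^n$ say that Bob wins at $x$ if $x$ has a zero and the largest $i$ with $x_i=0$ is odd; otherwise Alice wins at $x$. Let $E_1$ (resp. $E_0$) be the diagonal projector on $n$ qubits onto the span of the $|x\rangle$ at which Bob (resp. Alice) wins. Put $|\phi_i\rangle=\sqrt{a_i}\,|00\rangle+\sqrt{1-a_i}\,|11\rangle$ and let $|\psi\rangle=\bigotimes_{i=1}^n|\phi_i\rangle$, where for each $i$ one qubit of $|\phi_i\rangle$ belongs to Alice and the other to Bob. Assume that $\langle\psi|E_w\otimes E_w|\psi\rangle=\tfrac12$ for $w=0,1$, and let $$F_w=\frac{(E_w\otimes E_w)|\psi\rangle\langle\psi|(E_w\otimes E_w)}{\langle\psi|E_w\otimes E_w|\psi\rangle}.$$ Consider the following coin-flipping protocol with $n+2$ messages, in which output $0$ means that Alice wins and output $1$ that Bob wins. Alice prepares $|\phi_i\rangle$ for odd $i$ and Bob prepares $|\phi_i\rangle$ for even $i$. For $i=1,\dots,n$, message $i$ consists of one qubit of $|\phi_i\rangle$, sent by its owner to the other player. Then each player measures $\{E_0,E_1\}$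 on his or her own $n$ qubits. If Alice obtains $E_0$ she outputs $0$ and sends all her qubits to Bob (message $n+1$; otherwise she sends nothing). If Bob obtains $E_1$ he outputs $1$ and sends all his qubits to Alice (message $n+2$; otherwise he sends nothing). If Alice obtained $E_1$, she measures $\{F_1,I-F_1\}$ on her qubits together with those received from Bob and outputs $1$ if she obtains $F_1$, and $0$ otherwise or if the number of received qubits is wrong. If Bob obtained $E_0$, he measures $\{F_0,I-F_0\}$ on his qubits together with those received from Alice and outputs $0$ if he obtains $F_0$, and $1$ otherwise or if the number of received qubits is wrong. Let $P_B^*$ be the supremum, over all strategies of a cheating Bob against an honest Alice, of the probability that Alice outputs $1$, and let $P_A^*$ be the supremum, over all strategies of a cheating Alice against an honest Bob, of the probability that Bob outputs $0$. A cheater may start in any state that is unentangled with the honest player, use a private memory of any finite dimension, and perform arbitrary quantum operations on the memory and on the qubits under his or her control. For a real function $f$ on $\{0,1\}^i$ (the diagonal of a matrix on $i$ qubits) define functions on $\{0,1\}^{i-1}$ by $$(\mathrm{Tr}_{a_i}f)(x)=a_i f(x0)+(1-a_i)f(x1),\qquad (\mathrm{RMS}_{a_i}f)(x)=\sqrt{a_i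 f(x0)^2+(1-a_i)f(x1)^2}.$$ Then $$P_A^*\le\alpha=2\left(\mathrm{RMS}_{a_1}\mathrm{Tr}_{a_2}\mathrm{RMS}_{a_3}\mathrm{Tr}_{a_4}\cdots E_0\right)^2,\qquad P_B^*\le\beta=2\left(\mathrm{Tr}_{a_1}\mathrm{RMS}_{a_2}\mathrm{Tr}_{a_3}\mathrm{RMS}_{a_4}\cdots E_1\right)^2,$$ where $E_0,E_1$ stand for their diagonals and the two kinds of operations alternate: the innermost operation, on qubit $n$, is $\mathrm{Tr}_{a_n}$ in $\alpha$ and $\mathrm{RMS}_{a_n}$ in $\beta$ when $n$ is even, and $\mathrm{RMS}_{a_n}$ in $\alpha$ and $\mathrm{Tr}_{a_n}$ in $\beta$ when $n$ is odd. -/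

import Mathlib

open scoped Matrix Kronecker ComplexOrder

noncomputable section

namespace CoinFlip

/-- The two players. A player is also used as the name of a coin outcome: `alice` is outcome `0`
(Alice wins) and `bob` is outcome `1` (Bob wins). -/
inductive Party : Type
  | alice : Party
  | bob : Party
  deriving DecidableEq

instance : Fintype Party := ⟨{.alice, .bob}, fun p => by cases p <;> simp⟩

/-- The opponent. -/
def Party.other : Party → Party
  | .alice => .bob
  | .bob => .alice

/-- Messages, states `φ` and qubits are numbered from `0` here, so that Alice owns the states (and
sends the messages) number `0, 2, 4, …` and Bob those number `1, 3, 5, …`. -/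
def sender (k : ℕ) : Party := if Even k then .alice else .bob

/-- The `2n` particles carrying the qubits of the protocol: `(i, p)` is the half of the state `φ_i`
that is held by `p` after the first `n` messages. -/
abbrev Particle (n : ℕ) : Type := Fin n × Party

/-- Computational basis states of all `2n` particles (`false` is `|0⟩`, `true` is `|1⟩`). -/
abbrev Config (n : ℕ) : Type := Particle n → Bool

/-- The player controlling a particle once the first `k` messages have been sent. Message `i` hands
over the half `(i, p)` of `φ_i` with `p ≠ sender i`; before it both halves are with the sender. -/
def holder {n : ℕ} (k : ℕ) (q : Particle n) : Party :=
  if q.1.val < k then q.2 else sender q.1.val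

/-- The player who wins the coin toss when measuring `n` qubits gives `x`: the qubits are examined
from the last to the first, and the sender of the first zero that is found loses; if there is no
zero, Alice wins. -/
def winner {n : ℕ} (x : Fin n → Bool) : Party :=
  if ∃ i : Fin n, x i = false ∧ (∀ j : Fin n, i < j → x j = true) ∧ sender i.val = .alice
  then .bob else .alice

/-- The diagonal entries of the projector `E_w`. -/
def diagE {n : ℕ} (w : Party) (x : Fin n → Bool) : ℝ := if winner x = w then 1 else 0

/-- `E_w` acting on the `n` particles `(i, p)`, with the identity on the other `n` particles. -/
def projE (n : ℕ) (p w : Party) : Matrix (Config n) (Config n) ℂ :=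
  Matrix.diagonal fun x => (diagE w (fun i => x (i, p)) : ℂ)

/-- Amplitudes of the two-qubit state `√t |00⟩ + √(1-t) |11⟩`. -/
def phi (t : ℝ) (b b' : Bool) : ℂ :=
  if b = b' then (if b then (Real.sqrt (1 - t) : ℂ) else (Real.sqrt t : ℂ)) else 0

/-- The honest state `ψ` of all `2n` qubits after `n` messages. -/
def psi {n : ℕ} (a : Fin n → ℝ) : Config n → ℂ :=
  fun x => ∏ i, phi (a i) (x (i, .alice)) (x (i, .bob))

/-- The unnormalised vector `(E_w ⊗ E_w) ψ`. -/
def psiE {n : ℕ} (a : Fin n → ℝ) (w : Party) : Config n → ℂ :=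
  (projE n .alice w * projE n .bob w) *ᵥ psi a

/-- `⟨ψ| E_w ⊗ E_w |ψ⟩`, the probability that the honest coin has outcome `w`. -/
def honestProb {n : ℕ} (a : Fin n → ℝ) (w : Party) : ℂ := star (psi a) ⬝ᵥ psiE a w

/-- The projector `F_w` of the cheat detection stage. -/
def projF {n : ℕ} (a : Fin n → ℝ) (w : Party) : Matrix (Config n) (Config n) ℂ :=
  (honestProb a w)⁻¹ • Matrix.vecMulVec (psiE a w) (star (psiE a w))

/-- Basis of the space controlled by `c` once `k` messages have been sent: the particles held by
`c`, together with a private memory of dimension `d`. -/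
abbrev Local (n k : ℕ) (c : Party) (d : ℕ) : Type :=
  ({q : Particle n // holder k q = c} → Bool) × Fin d

/-- Basis of the joint space: all particles, and the private memory of the cheater. -/
abbrev Joint (n d : ℕ) : Type := Config n × Fin d

/-- The part of a joint basis state that is under the control of `c`. -/
def restrict {n d : ℕ} (k : ℕ) (c : Party) (u : Joint n d) : Local n k c d :=
  (fun q => u.1 q.1, u.2)

/-- An operator on the space controlled by `c`, tensored with the identity on all the particles
that `c` does not hold. -/
def extend {n d : ℕ} (k : ℕ) (c : Party) (K : Matrix (Local n k c d) (Local n k c d) ℂ) :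
    Matrix (Joint n d) (Joint n d) ℂ :=
  fun u v => if ∀ q, holder k q ≠ c → u.1 q = v.1 q
    then K (restrict k c u) (restrict k c v) else 0

/-- A cheating strategy of player `c` against an honest opponent. -/
structure Strategy (n : ℕ) (c : Party) : Type where
  /-- dimension of the private memory -/
  d : ℕ
  /-- the state in which the cheater prepares his or her own particles and memory -/
  init : Matrix (Local n 0 c d) (Local n 0 c d) ℂ
  init_psd : init.PosSemidef
  init_trace : init.trace = 1
  /-- number of Kraus operators of the operations below -/
  r : ℕ
  /-- Kraus operators of the quantum operation performed just before message `k` is sent -/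
  kraus : (k : Fin n) → Fin r → Matrix (Local n k c d) (Local n k c d) ℂ
  kraus_complete : ∀ k, ∑ j, (kraus k j)ᴴ * kraus k j = 1
  /-- Kraus operators of the operation performed after the first `n` messages, before the cheater's
  particles are sent to the opponent for inspection. It need not preserve the trace: the missing
  probability is that of not sending the right number of qubits. -/
  reply : Fin r → Matrix (Local n n c d) (Local n n c d) ℂ
  reply_le : (1 - ∑ j, (reply j)ᴴ * reply j).PosSemidef

namespace Strategy

variable {n : ℕ} {c : Party}

/-- The joint state after `k` messages. At the beginning the honest player prepares `φ_i` for every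
`i` that is his or hers, in a product state with the cheater's initial state. -/
def state (s : Strategy n c) (a : Fin n → ℝ) : ℕ → Matrix (Joint n s.d) (Joint n s.d) ℂ
  | 0 =>
    let amp : Config n → ℂ := fun x =>
      ∏ i : Fin n, if sender i.val = c.other then phi (a i) (x (i, .alice)) (x (i, .bob)) else 1
    fun u v => amp u.1 * star (amp v.1) * s.init (restrict 0 c u) (restrict 0 c v)
  | k + 1 =>
    if h : k < n then
      ∑ j, extend k c (s.kraus ⟨k, h⟩ j) * s.state a k * (extend k c (s.kraus ⟨k, h⟩ j))ᴴ
    else s.state a k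

/-- The probability that the honest player declares the cheater `c` the winner: the honest player
obtains `E_c` on his or her `n` qubits (otherwise the honest player has won), then receives the
cheater's particles, and obtains `F_c` on all `2n` qubits. -/
def winProb (s : Strategy n c) (a : Fin n → ℝ) : ℝ :=
  let P : Matrix (Joint n s.d) (Joint n s.d) ℂ := projE n c.other c ⊗ₖ 1
  let ρ : Matrix (Joint n s.d) (Joint n s.d) ℂ := P * s.state a n * Pᴴ
  let ρ' : Matrix (Joint n s.d) (Joint n s.d) ℂ :=
    ∑ j, extend n c (s.reply j) * ρ * (extend n c (s.reply j))ᴴ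
  ((projF a c ⊗ₖ (1 : Matrix (Fin s.d) (Fin s.d) ℂ)) * ρ').trace.re

end Strategy

/-- The supremum of the winning probabilities of player `c` over all cheating strategies. -/
def cheatProb {n : ℕ} (a : Fin n → ℝ) (c : Party) : EReal :=
  ⨆ s : Strategy n c, ((s.winProb a : ℝ) : EReal)

/-- Weighted mean over the last qubit of a diagonal matrix (given by its diagonal entries). -/
def meanLast {k : ℕ} (t : ℝ) (f : (Fin (k + 1) → Bool) → ℝ) : (Fin k → Bool) → ℝ :=
  fun x => t * f (Fin.snoc x false) + (1 - t) * f (Fin.snoc x true)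

/-- Weighted root mean square over the last qubit of a diagonal matrix. -/
def rmsLast {k : ℕ} (t : ℝ) (f : (Fin (k + 1) → Bool) → ℝ) : (Fin k → Bool) → ℝ :=
  fun x => Real.sqrt (t * f (Fin.snoc x false) ^ 2 + (1 - t) * f (Fin.snoc x true) ^ 2)

/-- The last, then the last but one, …, and finally the first qubit are eliminated, by the weighted
mean for the qubits sent by `p`, and by the weighted root mean square for the other qubits. -/
def alternating (p : Party) : {k : ℕ} → (Fin k → ℝ) → ((Fin k → Bool) → ℝ) → ℝ
  | 0, _, f => f Fin.elim0
  | k + 1, a, f =>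
    alternating p (fun i : Fin k => a i.castSucc)
      (if sender k = p then meanLast (a (Fin.last k)) f else rmsLast (a (Fin.last k)) f)

/-- The bound `α = 2 (RMS_{a_1} Tr_{a_2} RMS_{a_3} Tr_{a_4} ⋯ E_0)²` on Alice's cheating. -/
def alpha {n : ℕ} (a : Fin n → ℝ) : ℝ := 2 * alternating .bob a (diagE .alice) ^ 2

/-- The bound `β = 2 (Tr_{a_1} RMS_{a_2} Tr_{a_3} RMS_{a_4} ⋯ E_1)²` on Bob's cheating. -/
def beta {n : ℕ} (a : Fin n → ℝ) : ℝ := 2 * alternating .alice a (diagE .bob) ^ 2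

end CoinFlip

end

/-!
Let the honest player measure each of his or her qubits as soon as its place is fixed. The values
form a classical transcript, and if `s k x` is the probability that its first `k` bits are `x`, then
no operation of the cheater, who does not hold these qubits, changes `s k x`. A bit which the honest
player has sent half of is drawn from the weights `a_i, 1 - a_i` independently of the earlier bits,
because its pair has not been touched; the other bits are chosen by the cheater.

The vector `(E_c ⊗ E_c) ψ` is supported on the basis states `|x x⟩`, so by the triangle inequality
for the seminorm of a positive semidefinite matrix the test `F_c` is passed with probability at most
`(∑ x, E_c x * √(w x) * √(s n x))² / ⟨ψ| E_c ⊗ E_c |ψ⟩`, where `w x` is the honest probability of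
`x`. The sum is estimated by eliminating the bits from the last to the first: a bit sent by the
honest player contributes a weighted mean, and a bit sent by the cheater a weighted root mean
square, by the Cauchy–Schwarz inequality.
-/

noncomputable section

namespace CoinFlip

section Transcript

/-- The probability of each value of a bit obtained by measuring one half of
`√t |00⟩ + √(1-t) |11⟩`. -/
def weight (t : ℝ) (b : Bool) : ℝ := if b then 1 - t else t

theorem weight_nonneg {t : ℝ} (ht : t ∈ Set.Icc (0 : ℝ) 1) (b : Bool) : 0 ≤ weight t b := by
  cases b <;> simp [weight, ht.1, ht.2]

theorem sum_weight (t : ℝ) : ∑ b, weight t b = 1 := by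
  simp [weight]

theorem meanLast_apply {k : ℕ} (t : ℝ) (f : (Fin (k + 1) → Bool) → ℝ) (x : Fin k → Bool) :
    meanLast t f x = ∑ b, weight t b * f (Fin.snoc x b) := by
  simp [meanLast, weight, add_comm]

theorem rmsLast_apply {k : ℕ} (t : ℝ) (f : (Fin (k + 1) → Bool) → ℝ) (x : Fin k → Bool) :
    rmsLast t f x = √(∑ b, weight t b * f (Fin.snoc x b) ^ 2) := by
  simp [rmsLast, weight, add_comm]

theorem sum_snoc {α M : Type*} [Fintype α] [AddCommMonoid M] {k : ℕ}
    (f : (Fin (k + 1) → α) → M) : ∑ x, f x = ∑ y : Fin k → α, ∑ b, f (Fin.snoc y b) := by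
  rw [← (Fin.snocEquiv fun _ => α).sum_comp, Fintype.sum_prod_type_right]
  rfl

theorem sum_mul_sqrt_le_of_le_mul {β : Type*} [Fintype β] {f w q : β → ℝ} {r : ℝ}
    (hf : ∀ b, 0 ≤ f b) (hw : ∀ b, 0 ≤ w b) (hq : ∀ b, q b ≤ w b * r) :
    ∑ b, f b * (√(w b) * √(q b)) ≤ (∑ b, w b * f b) * √r := by
  rw [Finset.sum_mul]
  refine Finset.sum_le_sum fun b _ => ?_
  calc f b * (√(w b) * √(q b)) ≤ f b * (√(w b) * √(w b * r)) := by
        gcongr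
        exacts [hf b, hq b]
    _ = w b * f b * √r := by
        rw [Real.sqrt_mul (hw b), ← mul_assoc √(w b), Real.mul_self_sqrt (hw b)]
        ring

theorem sum_mul_sqrt_le_of_sum_le {β : Type*} [Fintype β] {f w q : β → ℝ} {r : ℝ}
    (hw : ∀ b, 0 ≤ w b) (hq : ∀ b, 0 ≤ q b) (hr : ∑ b, q b ≤ r) :
    ∑ b, f b * (√(w b) * √(q b)) ≤ √(∑ b, w b * f b ^ 2) * √r := by
  calc ∑ b, f b * (√(w b) * √(q b)) = ∑ b, √(w b) * f b * √(q b) :=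
        Finset.sum_congr rfl fun b _ => by ring
    _ ≤ √(∑ b, (√(w b) * f b) ^ 2) * √(∑ b, √(q b) ^ 2) :=
        Real.sum_mul_le_sqrt_mul_sqrt _ _ _
    _ = √(∑ b, w b * f b ^ 2) * √(∑ b, q b) := by
        simp only [mul_pow, Real.sq_sqrt (hw _), Real.sq_sqrt (hq _)]
    _ ≤ √(∑ b, w b * f b ^ 2) * √r := by gcongr

/-- The possible laws of the bits obtained by `p` when measuring one half of each pair: `s k x` is
the probability that the first `k` bits are `x`. The bit of a pair that `p` has prepared has the
weights `a k`, `1 - a k` independently of the earlier bits, and the other bits are arbitrary. Only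
inequalities are required, so that operations which lose probability are covered. -/
structure IsTranscriptLaw (p : Party) {n : ℕ} (a : Fin n → ℝ)
    (s : (k : ℕ) → (Fin k → Bool) → ℝ) : Prop where
  nonneg : ∀ k x, 0 ≤ s k x
  zero_le_one : ∀ x, s 0 x ≤ 1
  sum_snoc_le : ∀ (k : Fin n) (x : Fin k → Bool), ∑ b, s (k + 1) (Fin.snoc x b) ≤ s k x
  snoc_le : ∀ k : Fin n, sender k = p → ∀ (x : Fin k → Bool) (b : Bool),
    s (k + 1) (Fin.snoc x b) ≤ weight (a k) b * s k x

namespace IsTranscriptLaw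

variable {p : Party} {n : ℕ} {s : (k : ℕ) → (Fin k → Bool) → ℝ}

theorem init {a : Fin (n + 1) → ℝ} (hs : IsTranscriptLaw p a s) :
    IsTranscriptLaw p (fun i : Fin n => a i.castSucc) s where
  nonneg := hs.nonneg
  zero_le_one := hs.zero_le_one
  sum_snoc_le k := hs.sum_snoc_le k.castSucc
  snoc_le k := hs.snoc_le k.castSucc

theorem sum_last_mul_sqrt_le {a : Fin (n + 1) → ℝ} (hs : IsTranscriptLaw p a s)
    (ha : a (Fin.last n) ∈ Set.Icc (0 : ℝ) 1) {f : (Fin (n + 1) → Bool) → ℝ} (hf : ∀ x, 0 ≤ f x)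
    (x : Fin n → Bool) :
    ∑ b, f (Fin.snoc x b) * (√(weight (a (Fin.last n)) b) * √(s (n + 1) (Fin.snoc x b))) ≤
      (if sender n = p then meanLast (a (Fin.last n)) f else rmsLast (a (Fin.last n)) f) x *
        √(s n x) := by
  split_ifs with hp
  · rw [meanLast_apply]
    exact sum_mul_sqrt_le_of_le_mul (fun _ => hf _) (weight_nonneg ha)
      (hs.snoc_le (Fin.last n) hp x)
  · rw [rmsLast_apply]
    exact sum_mul_sqrt_le_of_sum_le (weight_nonneg ha) (fun _ => hs.nonneg _ _)
      (hs.sum_snoc_le (Fin.last n) x)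

theorem sum_mul_sqrt_le_alternating {a : Fin n → ℝ} (hs : IsTranscriptLaw p a s)
    (ha : ∀ i, a i ∈ Set.Icc (0 : ℝ) 1) {f : (Fin n → Bool) → ℝ} (hf : ∀ x, 0 ≤ f x) :
    ∑ x, f x * (√(∏ i, weight (a i) (x i)) * √(s n x)) ≤ alternating p a f := by
  induction n with
  | zero =>
    simp only [Finset.univ_eq_empty, Finset.prod_empty, Real.sqrt_one, one_mul,
      Fintype.sum_unique, alternating]
    exact mul_le_of_le_one_right (hf _) (Real.sqrt_le_one.2 (hs.zero_le_one _))
  | succ n ih =>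
    set g := if sender n = p then meanLast (a (Fin.last n)) f else rmsLast (a (Fin.last n)) f
    have hg : ∀ x, 0 ≤ g x := fun x => by
      unfold g
      split_ifs
      · exact (meanLast_apply _ _ _).ge.trans' (Finset.sum_nonneg fun b _ =>
          mul_nonneg (weight_nonneg (ha _) b) (hf _))
      · exact Real.sqrt_nonneg _
    have hprod : ∀ x : Fin n → Bool, 0 ≤ ∏ i, weight (a i.castSucc) (x i) := fun x =>
      Finset.prod_nonneg fun i _ => weight_nonneg (ha _) _
    calc ∑ x, f x * (√(∏ i, weight (a i) (x i)) * √(s (n + 1) x))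
        = ∑ x : Fin n → Bool, √(∏ i, weight (a i.castSucc) (x i)) * ∑ b, f (Fin.snoc x b) *
            (√(weight (a (Fin.last n)) b) * √(s (n + 1) (Fin.snoc x b))) := by
          rw [sum_snoc]
          refine Finset.sum_congr rfl fun x _ => ?_
          rw [Finset.mul_sum]
          refine Finset.sum_congr rfl fun b _ => ?_
          simp only [Fin.prod_univ_castSucc, Fin.snoc_castSucc, Fin.snoc_last,
            Real.sqrt_mul (hprod x)]
          ring
      _ ≤ ∑ x : Fin n → Bool, √(∏ i, weight (a i.castSucc) (x i)) * (g x * √(s n x)) := by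
          gcongr with x
          exact hs.sum_last_mul_sqrt_le (ha _) hf x
      _ = ∑ x, g x * (√(∏ i, weight (a i.castSucc) (x i)) * √(s n x)) :=
          Finset.sum_congr rfl fun x _ => by ring
      _ ≤ alternating p a f := ih hs.init (fun i => ha _) hg

end IsTranscriptLaw

end Transcript

section Matrices

variable {ι m κ 𝕜 : Type*} [RCLike 𝕜]

theorem trace_vecMulVec_star_mul [Fintype ι] (v : ι → 𝕜) (A : Matrix ι ι 𝕜) :
    (Matrix.vecMulVec v (star v) * A).trace = star v ⬝ᵥ (A *ᵥ v) := by
  rw [Matrix.vecMulVec_mul, Matrix.trace_vecMulVec, dotProduct_comm, Matrix.dotProduct_mulVec]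

theorem trace_mul_nonneg_of_posSemidef [Fintype ι] {A B : Matrix ι ι 𝕜} (hA : A.PosSemidef)
    (hB : B.PosSemidef) : 0 ≤ (A * B).trace := by
  obtain ⟨r, v, rfl⟩ := Matrix.posSemidef_iff_eq_sum_vecMulVec.1 hA
  rw [Finset.sum_mul, Matrix.trace_sum]
  refine Finset.sum_nonneg fun j _ => ?_
  rw [trace_vecMulVec_star_mul]
  exact hB.dotProduct_mulVec_nonneg _

open scoped MatrixOrder in
theorem re_dotProduct_mulVec_le_sq_sum [Fintype ι] {A : Matrix ι ι 𝕜} (hA : A.PosSemidef)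
    (v : ι → 𝕜) :
    RCLike.re (star v ⬝ᵥ (A *ᵥ v)) ≤ (∑ i, ‖v i‖ * √(RCLike.re (A i i))) ^ 2 := by
  classical
  obtain ⟨B, rfl⟩ := CStarAlgebra.nonneg_iff_eq_star_mul_self.1 hA.nonneg
  have norm_sq (w : ι → 𝕜) : ‖WithLp.toLp 2 w‖ ^ 2 = RCLike.re (star w ⬝ᵥ w) := by
    rw [@norm_sq_eq_re_inner 𝕜, EuclideanSpace.inner_toLp_toLp, dotProduct_comm]
  have norm_col (i : ι) : ‖WithLp.toLp 2 (B.col i)‖ = √(RCLike.re ((Bᴴ * B) i i)) := by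
    rw [← Real.sqrt_sq (norm_nonneg _), norm_sq]
    rfl
  have mulVec_eq : WithLp.toLp 2 (B *ᵥ v) = ∑ i, v i • WithLp.toLp 2 (B.col i) := by
    ext j
    simp [Matrix.mulVec, dotProduct, mul_comm]
  calc RCLike.re (star v ⬝ᵥ ((Bᴴ * B) *ᵥ v)) = ‖WithLp.toLp 2 (B *ᵥ v)‖ ^ 2 := by
        rw [norm_sq, Matrix.star_mulVec, ← Matrix.dotProduct_mulVec, Matrix.mulVec_mulVec]
    _ ≤ (∑ i, ‖v i‖ * √(RCLike.re ((Bᴴ * B) i i))) ^ 2 := by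
        rw [mulVec_eq]
        gcongr
        exact (norm_sum_le _ _).trans_eq (by simp only [norm_smul, norm_col])

/-- The completely positive map with Kraus operators `K`. -/
def krausMap [Fintype ι] [Fintype κ] (K : κ → Matrix m ι 𝕜) (ρ : Matrix ι ι 𝕜) : Matrix m m 𝕜 :=
  ∑ j, K j * ρ * (K j)ᴴ

section krausMap

variable [Fintype ι] [Fintype κ]

theorem posSemidef_krausMap [Finite m] (K : κ → Matrix m ι 𝕜) {ρ : Matrix ι ι 𝕜}
    (hρ : ρ.PosSemidef) : (krausMap K ρ).PosSemidef :=
  Matrix.posSemidef_sum _ fun _ _ => hρ.mul_mul_conjTranspose_same _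

theorem trace_krausMap_le [Fintype m] [DecidableEq ι] {K : κ → Matrix m ι 𝕜}
    (hK : (1 - ∑ j, (K j)ᴴ * K j).PosSemidef) {ρ : Matrix ι ι 𝕜} (hρ : ρ.PosSemidef) :
    (krausMap K ρ).trace ≤ ρ.trace := by
  have htrace : (krausMap K ρ).trace = ((∑ j, (K j)ᴴ * K j) * ρ).trace := by
    simp only [krausMap, Finset.sum_mul, Matrix.trace_sum]
    exact Finset.sum_congr rfl fun j _ => by rw [Matrix.trace_mul_comm, ← Matrix.mul_assoc]
  have hnonneg := trace_mul_nonneg_of_posSemidef hK hρ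
  rw [Matrix.sub_mul, Matrix.one_mul, Matrix.trace_sub, ← htrace] at hnonneg
  exact sub_nonneg.1 hnonneg

theorem krausMap_conj_of_commute {K : κ → Matrix ι ι 𝕜} {A : Matrix ι ι 𝕜}
    (hA : ∀ j, Commute A (K j)) (ρ : Matrix ι ι 𝕜) :
    krausMap K (A * ρ * Aᴴ) = A * krausMap K ρ * Aᴴ := by
  simp only [krausMap, Finset.mul_sum, Finset.sum_mul]
  refine Finset.sum_congr rfl fun j _ => ?_
  have hA' : (K j)ᴴ * Aᴴ = Aᴴ * (K j)ᴴ := by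
    rw [← Matrix.conjTranspose_mul, (hA j).eq, Matrix.conjTranspose_mul]
  calc K j * (A * ρ * Aᴴ) * (K j)ᴴ = (K j * A) * ρ * (Aᴴ * (K j)ᴴ) := by
        simp only [Matrix.mul_assoc]
    _ = A * (K j * ρ * (K j)ᴴ) * Aᴴ := by
        rw [← (hA j).eq, ← hA']
        simp only [Matrix.mul_assoc]

theorem krausMap_submatrix (K : κ → Matrix ι ι 𝕜) (ρ : Matrix ι ι 𝕜) (e : ι ≃ ι) :
    (krausMap K ρ).submatrix e e = krausMap (fun j => (K j).submatrix e e) (ρ.submatrix e e) := by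
  ext u v
  simp only [krausMap, Matrix.submatrix_apply, Matrix.sum_apply, Matrix.conjTranspose_submatrix,
    Matrix.submatrix_mul_equiv]

end krausMap

/-- The probability that measuring `ρ` in the computational basis gives an outcome in `S`. -/
def prob [Fintype ι] (ρ : Matrix ι ι 𝕜) (S : Set ι) : ℝ :=
  ∑ u, S.indicator (fun u => RCLike.re (ρ u u)) u

section prob

theorem re_conj_diagonal_apply_self [Fintype ι] [DecidableEq ι] (g : ι → 𝕜) (ρ : Matrix ι ι 𝕜)
    (u : ι) :
    RCLike.re ((Matrix.diagonal g * ρ * (Matrix.diagonal g)ᴴ) u u) =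
      ‖g u‖ ^ 2 * RCLike.re (ρ u u) := by
  rw [Matrix.diagonal_conjTranspose, Matrix.mul_diagonal, Matrix.diagonal_mul, mul_right_comm,
    Pi.star_apply, RCLike.star_def, RCLike.mul_conj, ← RCLike.ofReal_pow, RCLike.re_ofReal_mul]

theorem re_apply_self_nonneg {ρ : Matrix ι ι 𝕜} (hρ : ρ.PosSemidef) (u : ι) :
    0 ≤ RCLike.re (ρ u u) :=
  (RCLike.nonneg_iff.1 hρ.diag_nonneg).1

variable [Fintype ι] {ρ : Matrix ι ι 𝕜} {S T : Set ι}

theorem prob_nonneg (hρ : ρ.PosSemidef) (S : Set ι) : 0 ≤ prob ρ S :=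
  Finset.sum_nonneg fun _ _ => Set.indicator_nonneg (fun u _ => re_apply_self_nonneg hρ u) _

theorem prob_mono (hρ : ρ.PosSemidef) (h : S ⊆ T) : prob ρ S ≤ prob ρ T :=
  Finset.sum_le_sum fun _ _ =>
    Set.indicator_le_indicator_of_subset h (fun u => re_apply_self_nonneg hρ u) _

theorem sum_prob_inter_fiber {β : Type*} [Fintype β] (ρ : Matrix ι ι 𝕜) (S : Set ι) (f : ι → β) :
    ∑ b, prob ρ (S ∩ {u | f u = b}) = prob ρ S := by
  classical
  simp only [prob]
  rw [Finset.sum_comm]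
  refine Finset.sum_congr rfl fun u _ => ?_
  simp [Set.indicator_apply, ite_and, Finset.sum_ite_irrel]

theorem prob_submatrix (ρ : Matrix ι ι 𝕜) (S : Set ι) (e : ι ≃ ι) :
    prob (ρ.submatrix e e) (e ⁻¹' S) = prob ρ S :=
  e.sum_comp fun u => S.indicator (fun u => RCLike.re (ρ u u)) u

theorem prob_conj_diagonal_le [DecidableEq ι] (hρ : ρ.PosSemidef) {g : ι → 𝕜}
    (hg : ∀ u, ‖g u‖ ≤ 1) (S : Set ι) :
    prob (Matrix.diagonal g * ρ * (Matrix.diagonal g)ᴴ) S ≤ prob ρ S := by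
  refine Finset.sum_le_sum fun u _ => Set.indicator_le_indicator ?_
  rw [re_conj_diagonal_apply_self]
  exact mul_le_of_le_one_left (re_apply_self_nonneg hρ u) (pow_le_one₀ (norm_nonneg _) (hg u))

theorem prob_eq_re_trace [DecidableEq ι] (ρ : Matrix ι ι 𝕜) (S : Set ι) :
    prob ρ S = RCLike.re
      (Matrix.diagonal (S.indicator 1) * ρ * (Matrix.diagonal (S.indicator 1))ᴴ).trace := by
  classical
  simp only [prob, Matrix.trace, Matrix.diag_apply, map_sum, re_conj_diagonal_apply_self]
  refine Finset.sum_congr rfl fun u _ => ?_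
  by_cases hu : u ∈ S <;> simp [hu]

theorem prob_krausMap_le [Fintype κ] [DecidableEq ι] {K : κ → Matrix ι ι 𝕜}
    (hK : (1 - ∑ j, (K j)ᴴ * K j).PosSemidef) (hρ : ρ.PosSemidef)
    (hS : ∀ j, Commute (Matrix.diagonal (S.indicator 1)) (K j)) :
    prob (krausMap K ρ) S ≤ prob ρ S := by
  rw [prob_eq_re_trace, prob_eq_re_trace, ← krausMap_conj_of_commute hS]
  exact (RCLike.le_iff_re_im.1 (trace_krausMap_le hK (hρ.mul_mul_conjTranspose_same _))).1

end prob

/-- The partial trace over the second factor. -/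
def partialTrace [Fintype m] (ρ : Matrix (ι × m) (ι × m) 𝕜) : Matrix ι ι 𝕜 :=
  ∑ l, ρ.submatrix (fun z => (z, l)) fun z => (z, l)

section partialTrace

variable [Fintype m]

theorem posSemidef_partialTrace {ρ : Matrix (ι × m) (ι × m) 𝕜} (hρ : ρ.PosSemidef) :
    (partialTrace ρ).PosSemidef :=
  Matrix.posSemidef_sum _ fun _ _ => hρ.submatrix _

variable [Fintype ι]

theorem trace_kronecker_one_mul [DecidableEq m] (A : Matrix ι ι 𝕜)
    (ρ : Matrix (ι × m) (ι × m) 𝕜) :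
    ((A ⊗ₖ (1 : Matrix m m 𝕜)) * ρ).trace = (A * partialTrace ρ).trace := by
  simp only [Matrix.trace, Matrix.diag_apply, Matrix.mul_apply, Fintype.sum_prod_type,
    Matrix.kroneckerMap_apply, Matrix.one_apply, mul_ite, mul_one, mul_zero, ite_mul, zero_mul,
    Finset.sum_ite_eq, Finset.mem_univ, if_true, partialTrace, Matrix.sum_apply,
    Matrix.submatrix_apply, Finset.mul_sum]

theorem re_partialTrace_apply_self (ρ : Matrix (ι × m) (ι × m) 𝕜) (z : ι) :
    RCLike.re (partialTrace ρ z z) = prob ρ {u | u.1 = z} := by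
  classical
  simp [partialTrace, prob, Matrix.sum_apply, Fintype.sum_prod_type_right, Set.indicator_apply]

end partialTrace

end Matrices

section Protocol

variable {n d k : ℕ} {c p : Party} {i : Fin n} {a : Fin n → ℝ}

theorem Party.other_ne (c : Party) : c.other ≠ c := by
  cases c <;> simp [Party.other]

theorem Party.eq_other_iff_ne : p = c.other ↔ p ≠ c := by
  cases c <;> cases p <;> simp [Party.other]

theorem holder_of_lt (h : i.val < k) : holder k (i, p) = p := if_pos h

theorem holder_of_le (h : k ≤ i.val) : holder k (i, p) = sender i := if_neg h.not_gt

section Extend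

/-- A joint basis state splits into the part controlled by `c` and the remaining particles. -/
def splitEquiv (n d k : ℕ) (c : Party) :
    Joint n d ≃ Local n k c d × ({q : Particle n // ¬ holder k q = c} → Bool) :=
  ((Equiv.piEquivPiSubtypeProd (fun q : Particle n => holder k q = c) fun _ => Bool).prodCongr
    (Equiv.refl (Fin d))).trans (Equiv.prodAssoc _ _ _ |>.trans <|
      (Equiv.refl _).prodCongr (Equiv.prodComm _ _) |>.trans (Equiv.prodAssoc _ _ _).symm)

theorem splitEquiv_apply (u : Joint n d) :
    splitEquiv n d k c u = (restrict k c u, fun q => u.1 q.1) := rfl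

theorem extend_eq_submatrix_kronecker (K : Matrix (Local n k c d) (Local n k c d) ℂ) :
    extend k c K = (K ⊗ₖ 1).submatrix (splitEquiv n d k c) (splitEquiv n d k c) := by
  ext u v
  simp only [extend, Matrix.submatrix_apply, splitEquiv_apply, Matrix.kroneckerMap_apply,
    Matrix.one_apply, mul_ite, mul_one, mul_zero, funext_iff, Subtype.forall]

theorem conjTranspose_extend_mul_self (K : Matrix (Local n k c d) (Local n k c d) ℂ) :
    (extend k c K)ᴴ * extend k c K = extend k c (Kᴴ * K) := by
  simp only [extend_eq_submatrix_kronecker, Matrix.conjTranspose_submatrix,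
    Matrix.submatrix_mul_equiv, Matrix.conjTranspose_kronecker, ← Matrix.mul_kronecker_mul,
    Matrix.conjTranspose_one, Matrix.one_mul]

theorem extend_one : extend k c (1 : Matrix (Local n k c d) (Local n k c d) ℂ) = 1 := by
  rw [extend_eq_submatrix_kronecker, Matrix.one_kronecker_one, Matrix.submatrix_one_equiv]

theorem extend_one_sub_sum {κ : Type*} [Fintype κ]
    (K : κ → Matrix (Local n k c d) (Local n k c d) ℂ) :
    extend k c (1 - ∑ j, K j) = 1 - ∑ j, extend k c (K j) := by
  rw [← extend_one (k := k) (c := c)]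
  ext u v
  simp only [Matrix.sub_apply, Matrix.sum_apply, extend]
  split_ifs <;> simp

theorem posSemidef_one_sub_sum_extend {κ : Type*} [Fintype κ]
    {K : κ → Matrix (Local n k c d) (Local n k c d) ℂ}
    (hK : (1 - ∑ j, (K j)ᴴ * K j).PosSemidef) :
    (1 - ∑ j, (extend k c (K j))ᴴ * extend k c (K j)).PosSemidef := by
  simp only [conjTranspose_extend_mul_self, ← extend_one_sub_sum]
  rw [extend_eq_submatrix_kronecker]
  exact (hK.kronecker Matrix.PosSemidef.one).submatrix _

/-- The basis states `u` and `v` agree on all particles that `c` does not hold. These are the pairs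
for which `extend k c K` may have a nonzero entry, so that any observable that is constant along
this relation is unaffected by what `c` does. -/
def AgreeOutside (k : ℕ) (c : Party) (u v : Joint n d) : Prop :=
  ∀ q, holder k q ≠ c → u.1 q = v.1 q

theorem commute_diagonal_extend {g : Joint n d → ℂ} (hg : ∀ u v, AgreeOutside k c u v → g u = g v)
    (K : Matrix (Local n k c d) (Local n k c d) ℂ) :
    Commute (Matrix.diagonal g) (extend k c K) := by
  ext u v
  simp only [Matrix.diagonal_mul, Matrix.mul_diagonal, extend]
  split_ifs with h
  · rw [hg u v h, mul_comm]
  · simp only [mul_zero, zero_mul]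

theorem prob_krausMap_extend_le {κ : Type*} [Fintype κ]
    {K : κ → Matrix (Local n k c d) (Local n k c d) ℂ} {ρ : Matrix (Joint n d) (Joint n d) ℂ}
    {S : Set (Joint n d)} (hK : (1 - ∑ j, (K j)ᴴ * K j).PosSemidef) (hρ : ρ.PosSemidef)
    (hS : ∀ u v, AgreeOutside k c u v → (u ∈ S ↔ v ∈ S)) :
    prob (krausMap (fun j => extend k c (K j)) ρ) S ≤ prob ρ S := by
  refine prob_krausMap_le (posSemidef_one_sub_sum_extend hK) hρ fun j =>
    commute_diagonal_extend (fun u v h => ?_) _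
  classical
  simp only [Set.indicator_apply, hS u v h, Pi.one_apply]

end Extend

section Fresh

/-- Flip both halves of the pair number `i`. -/
def flipPair (i : Fin n) : Equiv.Perm (Joint n d) :=
  Function.Involutive.toPerm (fun u => (fun q => if q.1 = i then !u.1 q else u.1 q, u.2))
    fun u => Prod.ext (funext fun q => by by_cases h : q.1 = i <;> simp [h]) rfl

theorem flipPair_apply_self (u : Joint n d) : (flipPair i u).1 (i, p) = !u.1 (i, p) :=
  if_pos rfl

theorem flipPair_apply_of_ne (u : Joint n d) {q : Particle n} (h : q.1 ≠ i) :
    (flipPair i u).1 q = u.1 q := if_neg h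

theorem restrict_flipPair (hi : ∀ p, holder k (i, p) ≠ c) (u : Joint n d) :
    restrict k c (flipPair i u) = restrict k c u := by
  refine Prod.ext (funext fun q => flipPair_apply_of_ne u ?_) rfl
  rintro rfl
  exact hi q.1.2 q.2

theorem agreeOutside_flipPair {u v : Joint n d} :
    AgreeOutside k c (flipPair i u) (flipPair i v) ↔ AgreeOutside k c u v := by
  refine forall₂_congr fun q _ => ?_
  by_cases h : q.1 = i
  · obtain ⟨j, p⟩ := q
    obtain rfl : j = i := h
    rw [flipPair_apply_self, flipPair_apply_self, Bool.not_inj_iff]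
  · rw [flipPair_apply_of_ne _ h, flipPair_apply_of_ne _ h]

theorem extend_submatrix_flipPair (hi : ∀ p, holder k (i, p) ≠ c)
    (K : Matrix (Local n k c d) (Local n k c d) ℂ) :
    (extend k c K).submatrix (flipPair i) (flipPair i) = extend k c K := by
  ext u v
  simp only [Matrix.submatrix_apply, extend, restrict_flipPair hi]
  exact if_congr agreeOutside_flipPair rfl rfl

/-- Multiplication of each basis state by the amplitude in `√t |00⟩ + √(1-t) |11⟩` of its two
qubits number `i`. -/
def pairAmp (i : Fin n) (t : ℝ) : Matrix (Joint n d) (Joint n d) ℂ :=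
  Matrix.diagonal fun u => phi t (u.1 (i, .alice)) (u.1 (i, .bob))

/-- In the state `ρ` the pair number `i` is still in the state `√t |00⟩ + √(1-t) |11⟩`: apart from
the amplitudes of this pair, `ρ` does not change when both of its qubits are flipped. -/
def Fresh (i : Fin n) (t : ℝ) (ρ : Matrix (Joint n d) (Joint n d) ℂ) : Prop :=
  ∃ τ : Matrix (Joint n d) (Joint n d) ℂ, τ.submatrix (flipPair i) (flipPair i) = τ ∧
    ρ = pairAmp i t * τ * (pairAmp i t)ᴴ

variable {t : ℝ} {ρ : Matrix (Joint n d) (Joint n d) ℂ}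

theorem Fresh.krausMap_extend {κ : Type*} [Fintype κ] (h : Fresh i t ρ)
    (hi : ∀ p, holder k (i, p) ≠ c) (K : κ → Matrix (Local n k c d) (Local n k c d) ℂ) :
    Fresh i t (krausMap (fun j => extend k c (K j)) ρ) := by
  obtain ⟨τ, hτ, rfl⟩ := h
  refine ⟨krausMap (fun j => extend k c (K j)) τ, ?_, krausMap_conj_of_commute (fun j =>
    commute_diagonal_extend (fun u v huv => by rw [huv _ (hi _), huv _ (hi _)]) _) τ⟩
  simp only [krausMap_submatrix, hτ, extend_submatrix_flipPair hi]

theorem norm_phi_sq (ht : t ∈ Set.Icc (0 : ℝ) 1) (b b' : Bool) :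
    ‖phi t b b'‖ ^ 2 = if b = b' then weight t b else 0 := by
  cases b <;> cases b' <;> simp [phi, weight, Real.sq_sqrt, ht.1, ht.2]

theorem prob_conj_pairAmp (ht : t ∈ Set.Icc (0 : ℝ) 1) (τ : Matrix (Joint n d) (Joint n d) ℂ)
    (S : Set (Joint n d)) (p : Party) (b : Bool) :
    prob (pairAmp i t * τ * (pairAmp i t)ᴴ) (S ∩ {u | u.1 (i, p) = b}) =
      weight t b * prob τ (S ∩ {u | ∀ p, u.1 (i, p) = b}) := by
  classical
  simp only [prob, Finset.mul_sum, Set.indicator_apply, pairAmp, re_conj_diagonal_apply_self,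
    norm_phi_sq ht]
  refine Finset.sum_congr rfl fun u _ => ?_
  have forall_party : (∀ p, u.1 (i, p) = b) ↔ u.1 (i, .alice) = b ∧ u.1 (i, .bob) = b :=
    ⟨fun h => ⟨h _, h _⟩, fun h p => by cases p; exacts [h.1, h.2]⟩
  simp only [Set.mem_inter_iff, Set.mem_ofPred_eq, forall_party]
  cases p <;> grind

theorem prob_inter_pair_eq {τ : Matrix (Joint n d) (Joint n d) ℂ}
    (hτ : τ.submatrix (flipPair i) (flipPair i) = τ) {S : Set (Joint n d)}
    (hS : flipPair i ⁻¹' S = S) (b : Bool) :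
    prob τ (S ∩ {u | ∀ p, u.1 (i, p) = b}) = prob τ (S ∩ {u | ∀ p, u.1 (i, p) = false}) := by
  cases b with
  | false => rfl
  | true =>
    have preimage_eq : flipPair i ⁻¹' (S ∩ {u : Joint n d | ∀ p, u.1 (i, p) = true}) =
        S ∩ {u | ∀ p, u.1 (i, p) = false} := by
      rw [Set.preimage_inter, hS]
      simp only [Set.preimage_ofPred_eq, flipPair_apply_self, Bool.not_eq_true']
    rw [← preimage_eq, ← prob_submatrix τ _ (flipPair i), hτ]

theorem Fresh.prob_inter (h : Fresh i t ρ) (ht : t ∈ Set.Icc (0 : ℝ) 1) {S : Set (Joint n d)}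
    (hS : flipPair i ⁻¹' S = S) (p : Party) (b : Bool) :
    prob ρ (S ∩ {u | u.1 (i, p) = b}) = weight t b * prob ρ S := by
  obtain ⟨τ, hτ, rfl⟩ := h
  rw [← sum_prob_inter_fiber _ S fun u => u.1 (i, p)]
  simp only [prob_conj_pairAmp ht, prob_inter_pair_eq hτ hS]
  rw [← Finset.sum_mul, sum_weight, one_mul]

end Fresh

section InitialState

/-- The amplitudes of the product of the states `φ_i` prepared by the opponent of `c`. -/
def initAmp (a : Fin n → ℝ) (c : Party) (x : Config n) : ℂ :=
  ∏ i : Fin n, if sender i = c.other then phi (a i) (x (i, .alice)) (x (i, .bob)) else 1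

theorem sum_norm_phi_sq {t : ℝ} (ht : t ∈ Set.Icc (0 : ℝ) 1) :
    ∑ w : Party → Bool, ‖phi t (w .alice) (w .bob)‖ ^ 2 = 1 := by
  rw [← sum_weight t, eq_comm]
  refine Fintype.sum_of_injective (Function.const Party) (fun _ _ h => congrFun h .alice) _ _
    (fun w hw => ?_) fun b => by simp [norm_phi_sq ht]
  rw [norm_phi_sq ht, if_neg]
  exact fun h => hw ⟨w .alice, funext fun p => by cases p; exacts [rfl, h]⟩

theorem restrict_zero_eq_iff {u : Joint n d} {l : Local n 0 c d} :
    restrict 0 c u = l ↔ u.2 = l.2 ∧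
      ∀ (i : Fin n) (h : sender i = c), (fun p => u.1 (i, p)) = fun p => l.1 ⟨(i, p), h⟩ := by
  simp only [restrict, Prod.ext_iff, funext_iff, Subtype.forall, Prod.forall, and_comm]
  exact and_congr_right fun _ => forall_congr' fun i =>
    ⟨fun h hi p => h p hi, fun h p hi => h hi p⟩

theorem sum_config_prod (H : Fin n → (Party → Bool) → ℝ) :
    ∑ x : Config n, ∏ i, H i (fun p => x (i, p)) = ∏ i, ∑ w, H i w := by
  rw [Fintype.prod_sum]
  exact Fintype.sum_equiv (Equiv.curry _ _ _) _ _ fun _ => rfl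

theorem sum_norm_sq_initAmp (ha : ∀ i, a i ∈ Set.Icc (0 : ℝ) 1)
    (l : Local n 0 c d) :
    ∑ u : Joint n d, (if restrict 0 c u = l then ‖initAmp a c u.1‖ ^ 2 else 0) = 1 := by
  let H (i : Fin n) (w : Party → Bool) : ℝ :=
    if h : sender i = c then (if w = fun p => l.1 ⟨(i, p), h⟩ then 1 else 0)
    else ‖phi (a i) (w .alice) (w .bob)‖ ^ 2
  have sum_H (i : Fin n) : ∑ w, H i w = 1 := by
    by_cases h : sender i = c
    · simp only [H, dif_pos h, Finset.sum_ite_eq', Finset.mem_univ, if_true]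
    · simp only [H, dif_neg h, sum_norm_phi_sq (ha i)]
  have ite_eq_prod (u : Joint n d) : (if restrict 0 c u = l then ‖initAmp a c u.1‖ ^ 2 else 0) =
      if u.2 = l.2 then ∏ i, H i fun p => u.1 (i, p) else 0 := by
    by_cases hu : ∀ (i : Fin n) (h : sender i = c), (fun p => u.1 (i, p)) = fun p => l.1 ⟨(i, p), h⟩
    · simp only [restrict_zero_eq_iff, and_iff_left hu]
      rw [initAmp, norm_prod, ← Finset.prod_pow]
      refine if_congr Iff.rfl (Finset.prod_congr rfl fun i _ => ?_) rfl
      by_cases h : sender i = c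
      · simp [H, h, hu i h, (Party.other_ne c).symm]
      · simp [H, h, Party.eq_other_iff_ne]
    · rw [if_neg fun h => hu (restrict_zero_eq_iff.1 h).2]
      push Not at hu
      obtain ⟨i, h, hne⟩ := hu
      rw [Finset.prod_eq_zero (Finset.mem_univ i) (by simp only [H, dif_pos h, if_neg hne]),
        ite_self]
  simp only [ite_eq_prod, Fintype.sum_prod_type, Finset.sum_ite_eq', Finset.mem_univ, if_true,
    sum_config_prod, sum_H, Finset.prod_const_one]

end InitialState

section Past

/-- The event that the first `k` qubits of `p` have the values `x`; for indices beyond `n`, where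
there is no qubit, the value is not restricted. -/
def past (p : Party) (k : ℕ) (x : Fin k → Bool) : Set (Joint n d) :=
  {u | ∀ (j : Fin k) (h : j.val < n), u.1 (⟨j, h⟩, p) = x j}

theorem past_zero (x : Fin 0 → Bool) : (past p 0 x : Set (Joint n d)) = Set.univ :=
  Set.eq_univ_of_forall fun _ j => j.elim0

theorem past_snoc (k : Fin n) (x : Fin k → Bool) (b : Bool) :
    (past p (k + 1) (Fin.snoc x b) : Set (Joint n d)) = past p k x ∩ {u | u.1 (k, p) = b} := by
  ext u
  simp [past, Fin.forall_fin_succ', Fin.snoc_castSucc, Fin.snoc_last]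

theorem mem_past_iff_of_agreeOutside {x : Fin k → Bool} {u v : Joint n d}
    (h : AgreeOutside k c u v) : u ∈ past c.other k x ↔ v ∈ past c.other k x :=
  forall₂_congr fun j hj => by
    rw [h _ ((holder_of_lt j.is_lt).trans_ne (Party.other_ne c))]

theorem preimage_flipPair_past (k : Fin n) (x : Fin k → Bool) :
    flipPair k ⁻¹' past p k x = (past p k x : Set (Joint n d)) :=
  Set.ext fun u => forall₂_congr fun j _ => by
    rw [flipPair_apply_of_ne u (Fin.ne_of_lt j.is_lt)]

end Past

namespace Strategy

variable (s : Strategy n c)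

theorem state_zero (a : Fin n → ℝ) :
    s.state a 0 = Matrix.diagonal (fun u => initAmp a c u.1) *
      s.init.submatrix (restrict 0 c) (restrict 0 c) *
      (Matrix.diagonal fun u => initAmp a c u.1)ᴴ := by
  ext u v
  rw [Matrix.diagonal_conjTranspose, Matrix.mul_diagonal, Matrix.diagonal_mul,
    Matrix.submatrix_apply, Pi.star_apply, mul_right_comm]
  rfl

theorem state_succ (a : Fin n → ℝ) (k : Fin n) :
    s.state a (k + 1) = krausMap (fun j => extend k c (s.kraus k j)) (s.state a k) :=
  dif_pos k.is_lt

theorem posSemidef_one_sub_sum_kraus (k : Fin n) :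
    (1 - ∑ j, (s.kraus k j)ᴴ * s.kraus k j).PosSemidef := by
  rw [s.kraus_complete, sub_self]
  exact Matrix.PosSemidef.zero

theorem posSemidef_state (a : Fin n → ℝ) (k : ℕ) : (s.state a k).PosSemidef := by
  induction k with
  | zero =>
    rw [state_zero]
    exact (s.init_psd.submatrix _).mul_mul_conjTranspose_same _
  | succ k ih =>
    by_cases hk : k < n
    · rw [state_succ s a ⟨k, hk⟩]
      exact posSemidef_krausMap _ ih
    · rw [state, dif_neg hk]
      exact ih

theorem prob_state_zero_univ (ha : ∀ i, a i ∈ Set.Icc (0 : ℝ) 1) :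
    prob (s.state a 0) Set.univ = 1 := by
  have re_state (u : Joint n s.d) : RCLike.re (s.state a 0 u u) =
      ∑ l, (s.init l l).re * if restrict 0 c u = l then ‖initAmp a c u.1‖ ^ 2 else 0 := by
    rw [state_zero, re_conj_diagonal_apply_self]
    simp [mul_comm]
  have re_trace_init : ∑ l, (s.init l l).re = 1 := by
    simpa [Matrix.trace] using congrArg Complex.re s.init_trace
  simp only [prob, Set.indicator_univ, re_state]
  rw [Finset.sum_comm]
  simp only [← Finset.mul_sum, sum_norm_sq_initAmp ha, mul_one, re_trace_init]

theorem fresh_state_zero (a : Fin n → ℝ) (hi : sender i = c.other) :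
    Fresh i (a i) (s.state a 0) := by
  let rest (u : Joint n s.d) : ℂ := ∏ j ∈ Finset.univ.erase i,
    if sender j = c.other then phi (a j) (u.1 (j, .alice)) (u.1 (j, .bob)) else 1
  have initAmp_eq : Matrix.diagonal (fun u : Joint n s.d => initAmp a c u.1) =
      pairAmp i (a i) * Matrix.diagonal rest := by
    rw [pairAmp, Matrix.diagonal_mul_diagonal]
    congr 1
    ext u
    rw [initAmp, ← Finset.mul_prod_erase _ _ (Finset.mem_univ i), if_pos hi]
  have rest_flipPair (u : Joint n s.d) : rest (flipPair i u) = rest u :=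
    Finset.prod_congr rfl fun j hj => by
      have hji : j ≠ i := Finset.ne_of_mem_erase hj
      simp only [flipPair_apply_of_ne u (q := (j, _)) hji]
  have not_held (p : Party) : holder 0 (i, p) ≠ c :=
    (holder_of_le i.val.zero_le).trans_ne (hi.trans_ne (Party.other_ne c))
  refine ⟨Matrix.diagonal rest * s.init.submatrix (restrict 0 c) (restrict 0 c) *
    (Matrix.diagonal rest)ᴴ, ?_, ?_⟩
  · ext u v
    simp only [Matrix.diagonal_conjTranspose, Matrix.submatrix_apply, Matrix.mul_diagonal,
      Matrix.diagonal_mul, Pi.star_apply, rest_flipPair, restrict_flipPair not_held]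
  · rw [state_zero, initAmp_eq, Matrix.conjTranspose_mul]
    simp only [Matrix.mul_assoc]

theorem fresh_state (a : Fin n → ℝ) (hi : sender i = c.other) (hk : k ≤ i) :
    Fresh i (a i) (s.state a k) := by
  induction k with
  | zero => exact s.fresh_state_zero a hi
  | succ k ih =>
    rw [s.state_succ a ⟨k, hk.trans_lt i.is_lt |>.le⟩]
    exact (ih (Nat.le_of_succ_le hk)).krausMap_extend (fun p =>
      (holder_of_le (Nat.le_of_succ_le hk)).trans_ne (hi.trans_ne (Party.other_ne c))) _

theorem isTranscriptLaw (ha : ∀ i, a i ∈ Set.Icc (0 : ℝ) 1) :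
    IsTranscriptLaw c.other a fun k x => prob (s.state a k) (past c.other k x) where
  nonneg k x := prob_nonneg (s.posSemidef_state a k) _
  zero_le_one x := by rw [past_zero, s.prob_state_zero_univ ha]
  sum_snoc_le k x := by
    simp only [past_snoc, sum_prob_inter_fiber, state_succ]
    exact prob_krausMap_extend_le (s.posSemidef_one_sub_sum_kraus k) (s.posSemidef_state a k)
      fun u v => mem_past_iff_of_agreeOutside
  snoc_le k hk x b := by
    rw [past_snoc, ← (s.fresh_state a hk le_rfl).prob_inter (ha k) (preimage_flipPair_past k x)
      c.other b, state_succ]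
    refine prob_krausMap_extend_le (s.posSemidef_one_sub_sum_kraus k) (s.posSemidef_state a k)
      fun u v h => and_congr (mem_past_iff_of_agreeOutside h) ?_
    have not_held : holder k (k, c.other) ≠ c :=
      (holder_of_le le_rfl).trans_ne (hk.trans_ne (Party.other_ne c))
    exact Eq.congr_left (h _ not_held)

end Strategy

section Detection

theorem diagE_nonneg (w : Party) (x : Fin n → Bool) : 0 ≤ diagE w x := by
  unfold diagE
  split_ifs <;> norm_num

theorem diagE_le_one (w : Party) (x : Fin n → Bool) : diagE w x ≤ 1 := by
  unfold diagE
  split_ifs <;> norm_num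

theorem diagE_mul_self (w : Party) (x : Fin n → Bool) : diagE w x * diagE w x = diagE w x := by
  unfold diagE
  split_ifs <;> norm_num

/-- The basis state in which both halves of the pair number `i` have the value `x i`; only these
basis states occur in the honest state. -/
def double (x : Fin n → Bool) : Config n := fun q => x q.1

theorem double_injective : Function.Injective (double : (Fin n → Bool) → Config n) :=
  fun _ _ h => funext fun i => congrFun h (i, .alice)

theorem psiE_apply (a : Fin n → ℝ) (w : Party) (z : Config n) :
    psiE a w z = diagE w (fun i => z (i, .alice)) * diagE w (fun i => z (i, .bob)) * psi a z := by
  rw [psiE, projE, projE, Matrix.diagonal_mul_diagonal, Matrix.mulVec_diagonal]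

theorem psiE_eq_zero (a : Fin n → ℝ) (w : Party) {z : Config n} (hz : z ∉ Set.range double) :
    psiE a w z = 0 := by
  obtain ⟨i, hi⟩ : ∃ i, z (i, .alice) ≠ z (i, .bob) := by
    by_contra! h
    exact hz ⟨fun i => z (i, .alice), funext fun ⟨i, p⟩ => by cases p; exacts [rfl, h i]⟩
  rw [psiE_apply, psi, Finset.prod_eq_zero (Finset.mem_univ i) (if_neg hi), mul_zero]

theorem norm_psiE_double (ha : ∀ i, a i ∈ Set.Icc (0 : ℝ) 1) (w : Party) (x : Fin n → Bool) :
    ‖psiE a w (double x)‖ = diagE w x * √(∏ i, weight (a i) (x i)) := by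
  have norm_psi : ‖psi a (double x)‖ = √(∏ i, weight (a i) (x i)) := by
    rw [← Real.sqrt_sq (norm_nonneg _), psi, norm_prod, ← Finset.prod_pow]
    simp only [norm_phi_sq (ha _), double, if_true]
  rw [psiE_apply, norm_mul, norm_psi, ← Complex.ofReal_mul, Complex.norm_real]
  change ‖diagE w x * diagE w x‖ * _ = _
  rw [diagE_mul_self, Real.norm_of_nonneg (diagE_nonneg w x)]

theorem honestProb_nonneg (a : Fin n → ℝ) (w : Party) : 0 ≤ honestProb a w := by
  have diag_nonneg (p : Party) (z : Config n) : 0 ≤ diagE w fun i => z (i, p) := diagE_nonneg _ _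
  rw [honestProb, psiE, projE, projE, Matrix.diagonal_mul_diagonal]
  refine (Matrix.PosSemidef.diagonal fun z => ?_).dotProduct_mulVec_nonneg _
  rw [← Complex.ofReal_mul, Pi.zero_apply, Complex.zero_le_real]
  exact mul_nonneg (diag_nonneg .alice z) (diag_nonneg .bob z)

theorem prob_conj_projE_le {ρ : Matrix (Joint n d) (Joint n d) ℂ} (hρ : ρ.PosSemidef)
    (p w : Party) (S : Set (Joint n d)) :
    prob ((projE n p w ⊗ₖ (1 : Matrix (Fin d) (Fin d) ℂ)) * ρ *
      (projE n p w ⊗ₖ (1 : Matrix (Fin d) (Fin d) ℂ))ᴴ) S ≤ prob ρ S := by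
  rw [projE, ← Matrix.diagonal_one, Matrix.diagonal_kronecker_diagonal]
  refine prob_conj_diagonal_le hρ (fun u => ?_) S
  rw [mul_one, Complex.norm_real, Real.norm_of_nonneg (diagE_nonneg _ _)]
  exact diagE_le_one _ _

namespace Strategy

variable (s : Strategy n c)

/-- The joint state that the honest player inspects: the projection onto the case that the honest
player's measurement declares `c` the winner (unnormalised), followed by the cheater's reply. -/
def replyState (a : Fin n → ℝ) : Matrix (Joint n s.d) (Joint n s.d) ℂ :=
  krausMap (fun j => extend n c (s.reply j))
    ((projE n c.other c ⊗ₖ 1) * s.state a n * (projE n c.other c ⊗ₖ 1)ᴴ)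

theorem posSemidef_replyState (a : Fin n → ℝ) : (s.replyState a).PosSemidef :=
  posSemidef_krausMap _ ((s.posSemidef_state a n).mul_mul_conjTranspose_same _)

theorem prob_replyState_past_le (a : Fin n → ℝ) (x : Fin n → Bool) :
    prob (s.replyState a) (past c.other n x) ≤ prob (s.state a n) (past c.other n x) :=
  (prob_krausMap_extend_le s.reply_le ((s.posSemidef_state a n).mul_mul_conjTranspose_same _)
    fun _ _ => mem_past_iff_of_agreeOutside).trans
      (prob_conj_projE_le (s.posSemidef_state a n) _ _ _)

theorem re_partialTrace_replyState_double_le (a : Fin n → ℝ) (x : Fin n → Bool) :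
    (partialTrace (s.replyState a) (double x) (double x)).re ≤
      prob (s.state a n) (past c.other n x) :=
  calc (partialTrace (s.replyState a) (double x) (double x)).re
      = prob (s.replyState a) {u | u.1 = double x} :=
        re_partialTrace_apply_self (𝕜 := ℂ) _ _
    _ ≤ prob (s.replyState a) (past c.other n x) :=
        prob_mono (s.posSemidef_replyState a) fun _ hu _ _ => congrFun hu _
    _ ≤ prob (s.state a n) (past c.other n x) := s.prob_replyState_past_le a x

theorem winProb_eq (a : Fin n → ℝ) :
    s.winProb a = ((honestProb a c)⁻¹ *
      (star (psiE a c) ⬝ᵥ (partialTrace (s.replyState a) *ᵥ psiE a c))).re := by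
  change ((projF a c ⊗ₖ (1 : Matrix (Fin s.d) (Fin s.d) ℂ)) * s.replyState a).trace.re = _
  rw [trace_kronecker_one_mul, projF, Matrix.smul_mul, Matrix.trace_smul,
    trace_vecMulVec_star_mul, smul_eq_mul]

theorem sum_norm_psiE_mul_sqrt_le (ha : ∀ i, a i ∈ Set.Icc (0 : ℝ) 1) :
    ∑ z, ‖psiE a c z‖ * √(partialTrace (s.replyState a) z z).re ≤
      alternating c.other a (diagE c) := by
  calc ∑ z, ‖psiE a c z‖ * √(partialTrace (s.replyState a) z z).re
      = ∑ x, ‖psiE a c (double x)‖ * √(partialTrace (s.replyState a) (double x) (double x)).re :=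
        (Fintype.sum_of_injective double double_injective _ _
          (fun z hz => by rw [psiE_eq_zero a c hz, norm_zero, zero_mul]) fun x => rfl).symm
    _ ≤ ∑ x, diagE c x * (√(∏ i, weight (a i) (x i)) *
          √(prob (s.state a n) (past c.other n x))) := by
        refine Finset.sum_le_sum fun x _ => ?_
        rw [norm_psiE_double ha, mul_assoc]
        gcongr
        exacts [diagE_nonneg c x, s.re_partialTrace_replyState_double_le a x]
    _ ≤ alternating c.other a (diagE c) :=
        (s.isTranscriptLaw ha).sum_mul_sqrt_le_alternating ha (diagE_nonneg c)

theorem winProb_le (ha : ∀ i, a i ∈ Set.Icc (0 : ℝ) 1) (h : honestProb a c ≠ 0) :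
    s.winProb a ≤ alternating c.other a (diagE c) ^ 2 / (honestProb a c).re := by
  have re_pos : 0 < (honestProb a c).re :=
    (Complex.pos_iff.1 ((honestProb_nonneg a c).lt_of_ne' h)).1
  have ofReal_re : ((honestProb a c).re : ℂ) = honestProb a c :=
    (Complex.eq_re_of_ofReal_le (r := 0) (honestProb_nonneg a c)).symm
  rw [winProb_eq, ← ofReal_re, ← Complex.ofReal_inv, Complex.re_ofReal_mul, Complex.ofReal_re,
    div_eq_inv_mul]
  gcongr
  calc (star (psiE a c) ⬝ᵥ (partialTrace (s.replyState a) *ᵥ psiE a c)).re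
      ≤ (∑ z, ‖psiE a c z‖ * √(partialTrace (s.replyState a) z z).re) ^ 2 :=
        re_dotProduct_mulVec_le_sq_sum
          (posSemidef_partialTrace (s.posSemidef_replyState a)) (psiE a c)
    _ ≤ alternating c.other a (diagE c) ^ 2 :=
        pow_le_pow_left₀ (Finset.sum_nonneg fun _ _ => mul_nonneg (norm_nonneg _)
          (Real.sqrt_nonneg _)) (s.sum_norm_psiE_mul_sqrt_le ha) 2

end Strategy

end Detection

end Protocol

end CoinFlip

end

theorem theorem2_general {n : ℕ} {a : Fin n → ℝ} (ha : ∀ i, a i ∈ Set.Icc (0 : ℝ) 1)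
    {c : CoinFlip.Party} (h : CoinFlip.honestProb a c ≠ 0) :
    CoinFlip.cheatProb a c ≤ ((CoinFlip.alternating c.other a (CoinFlip.diagE c) ^ 2 /
      (CoinFlip.honestProb a c).re : ℝ) : EReal) :=
  iSup_le fun s => EReal.coe_le_coe_iff.2 (s.winProb_le ha h)

theorem theorem2 (n : ℕ) (hn : 2 ≤ n) (a : Fin n → ℝ)
    (ha : ∀ i, a i ∈ Set.Icc (0 : ℝ) 1)
    (hfair : ∀ w : CoinFlip.Party, CoinFlip.honestProb a w = 1 / 2) :
    CoinFlip.cheatProb a .alice ≤ ((CoinFlip.alpha a : ℝ) : EReal) ∧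
      CoinFlip.cheatProb a .bob ≤ ((CoinFlip.beta a : ℝ) : EReal) := by
  constructor
  · simpa [CoinFlip.alpha, CoinFlip.Party.other, hfair, div_eq_mul_inv, mul_comm] using
      theorem2_general ha (c := .alice) (by simp [hfair])
  · simpa [CoinFlip.beta, CoinFlip.Party.other, hfair, div_eq_mul_inv, mul_comm] using
      theorem2_general ha (c := .bob) (by simp [hfair])
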